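/- Let $n \ge 3$ and let $({\bf M}, g)$ be a smooth Riemannian manifold (without boundary) of dimension $n$, with Riemannian distance $d$, volume measure $\mu(g)$ and scalar curvature $R$. Let $x_0 \in {\bf M}$, $r \in (0,1]$, and let $B(x_0, r) = \{x : d(x_0,x) < r\}$ be a proper geodesic ball, i.e. ${\bf M} \setminus B(x_0, r) \neq \emptyset$. Assume that the closed balls $\{x : d(x_0,x) \le \rho\}$, $\rho < r$, are compact (this is automatic if ${\bf M}$ is compact, or, more generally, complete). Suppose that $|R(x)| \le 1/r^2$ for all $x \in B(x_0, r)$, and that for a constant $A \ge 1$ the following Sobolev inequality holds for all $v \in W^{1,2}_0(B(x_0, r))$, where $W_0^{1,2}(B(x_0,r))$ is the closure of $C_c^\infty(B(x_0,r))$ in the norm $\left(\int v^2\, d\mu(g) + \int |\nabla v|^2\, d\mu(g)\right)^{1/2}$: \[ \left( \int |v|^{2n/(n-2)}\, d\mu(g) \right)^{(n-2)/n} \le A \int \left( |\nabla v|^2 + \tfrac14 R v^2 \right) d\mu(g) + A \int v^2\, d\mu(g) . \] Then \[ |B(x_0, r)| := \mu(g)(B(x_0,r)) \ge 2^{-(n+5)n/2}\,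 A^{-n/2}\, r^n . \] -/

import Mathlib

open scoped Manifold ContDiff Bundle Topology
open MeasureTheory Bundle

noncomputable section

namespace RiemannianVolumeBound

section Coordinates

variable {n : ℕ} {M : Type*} [TopologicalSpace M] [ChartedSpace (EuclideanSpace ℝ (Fin n)) M]
  [RiemannianBundle (fun x : M ↦ TangentSpace (𝓡 n) x)]

/-- The coordinate vector field `∂ᵢ` of the preferred chart at `c`, at the point with
coordinates `y` (meaningful for `y` in the target of the chart). -/
def coordVec (c : M) (y : EuclideanSpace ℝ (Fin n)) (i : Fin n) :
    TangentSpace (𝓡 n) ((extChartAt (𝓡 n) c).symm y) :=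
  mfderiv (𝓡 n) (𝓡 n) (extChartAt (𝓡 n) c).symm y (EuclideanSpace.single i (1 : ℝ))

/-- The metric coefficients `g_ij = ⟪∂ᵢ, ∂ⱼ⟫` in the chart at `c`. -/
def metricCoeff (c : M) (y : EuclideanSpace ℝ (Fin n)) : Matrix (Fin n) (Fin n) ℝ :=
  Matrix.of fun i j ↦ inner ℝ (coordVec c y i) (coordVec c y j)

/-- The partial derivative `∂ᵢ f` of a function of the coordinates. -/
def partialDeriv (i : Fin n) (f : EuclideanSpace ℝ (Fin n) → ℝ)
    (y : EuclideanSpace ℝ (Fin n)) : ℝ :=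
  fderiv ℝ f y (EuclideanSpace.single i (1 : ℝ))

/-- The Christoffel symbols `Γᵏ_ij = ½ gᵏˡ (∂ᵢ g_jl + ∂ⱼ g_il - ∂ₗ g_ij)` of the Levi-Civita
connection in the chart at `c`. -/
def christoffel (c : M) (k i j : Fin n) (y : EuclideanSpace ℝ (Fin n)) : ℝ :=
  (1 / 2 : ℝ) * ∑ l, (metricCoeff c y)⁻¹ k l *
    (partialDeriv i (fun z ↦ metricCoeff c z j l) y
      + partialDeriv j (fun z ↦ metricCoeff c z i l) y
      - partialDeriv l (fun z ↦ metricCoeff c z i j) y)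

/-- The components of the Ricci tensor in the chart at `c`:
`R_ij = ∂ₖ Γᵏ_ij - ∂ⱼ Γᵏ_ik + Γᵏ_kl Γˡ_ij - Γᵏ_jl Γˡ_ik`
(the sign convention for which round spheres have positive Ricci curvature). -/
def ricciCoeff (c : M) (i j : Fin n) (y : EuclideanSpace ℝ (Fin n)) : ℝ :=
  ∑ k, (partialDeriv k (christoffel c k i j) y - partialDeriv j (christoffel c k i k) y
    + ∑ l, (christoffel c k k l y * christoffel c l i j y
      - christoffel c k j l y * christoffel c l i k y))

variable (n) in
/-- The scalar curvature `R = gⁱʲ R_ij` at `x`, computed in the preferred chart at `x`. -/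
def scalarCurvature (x : M) : ℝ :=
  ∑ i, ∑ j, (metricCoeff x (extChartAt (𝓡 n) x x))⁻¹ i j *
    ricciCoeff x i j (extChartAt (𝓡 n) x x)

variable [MeasurableSpace M]

variable (n) in
/-- The measure `√(det g_ij) dy` of the chart at `c`, as a measure on `M` that is concentrated
on the domain of that chart. -/
def chartVolume (c : M) : Measure M :=
  (((volume : Measure (EuclideanSpace ℝ (Fin n))).restrict (extChartAt (𝓡 n) c).target).withDensity
    (fun y ↦ ENNReal.ofReal (Real.sqrt (metricCoeff c y).det))).map (extChartAt (𝓡 n) c).symm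

variable (n M) in
/-- The Riemannian volume measure `μ(g)`. The measures `√(det g_ij) dy` of any two charts agree on
the intersection of the chart domains, so their supremum (the least measure that dominates all of
them) is the one measure on `M` that restricts to `√(det g_ij) dy` on each chart domain. -/
def riemannianVolume : Measure M :=
  ⨆ c : M, chartVolume n c

variable (n) in
/-- The differential `dφ` at `x`, as a covector. -/
def differential (φ : M → ℝ) (x : M) : TangentSpace (𝓡 n) x →L[ℝ] ℝ :=
  mfderiv (𝓡 n) 𝓘(ℝ, ℝ) φ x

variable [IsManifold (𝓡 n) ∞ M]

/-- A field of covectors `G` is (almost everywhere) measurable if its pairing with each smooth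
vector field is an a.e. measurable function. -/
def AEMeasurableCovectorField (G : ∀ x : M, TangentSpace (𝓡 n) x →L[ℝ] ℝ) : Prop :=
  ∀ X : ∀ x : M, TangentSpace (𝓡 n) x,
    ContMDiff (𝓡 n) (𝓡 n).tangent ∞
      (fun x ↦ (⟨x, X x⟩ : TangentBundle (𝓡 n) M)) →
    AEMeasurable (fun x ↦ G x (X x)) (riemannianVolume n M)

variable (n) in
/-- The test functions `C_c^∞(B)`: smooth functions on `M` with compact support inside `B`. -/
def IsTestFunction (B : Set M) (φ : M → ℝ) : Prop :=
  ContMDiff (𝓡 n) 𝓘(ℝ, ℝ) ∞ φ ∧ HasCompactSupport φ ∧ tsupport φ ⊆ B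

/-- `v ∈ W₀^{1,2}(B)` with weak differential `G`. The space `W₀^{1,2}(B)` is the closure of
`C_c^∞(B)` in the norm `(∫ v² + ∫ |∇v|²)^{1/2}`: some sequence `φₖ` in `C_c^∞(B)` satisfies
`φₖ → v` and `dφₖ → G` in `L²`. The function `v` (defined on all of `M`, and zero almost everywhere
off `B`) determines `G` almost everywhere. The norm `‖G x‖` is the dual norm of the metric, so
`‖G x‖ = |∇v|(x)`. -/
def IsW012 (B : Set M) (v : M → ℝ) (G : ∀ x : M, TangentSpace (𝓡 n) x →L[ℝ] ℝ) : Prop :=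
  AEMeasurable v (riemannianVolume n M) ∧ AEMeasurableCovectorField G ∧
    ∃ φ : ℕ → M → ℝ, (∀ k, IsTestFunction n B (φ k)) ∧
      Filter.Tendsto (fun k ↦ ∫⁻ x, ‖φ k x - v x‖ₑ ^ 2 ∂(riemannianVolume n M))
        Filter.atTop (𝓝 0) ∧
      Filter.Tendsto
        (fun k ↦ ∫⁻ x, ‖differential n (φ k) x - G x‖ₑ ^ 2
          ∂(riemannianVolume n M))
        Filter.atTop (𝓝 0)

variable (n) in
/-- The Sobolev inequality on `W₀^{1,2}(B)`, perturbed by the scalar curvature, with constant `A`: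
the left-hand integral is finite, and
`(∫ |v|^{2n/(n-2)})^{(n-2)/n} ≤ A ∫ (|∇v|² + ¼ R v²) + A ∫ v²`. -/
def PerturbedSobolev (B : Set M) (A : ℝ) : Prop :=
  ∀ (v : M → ℝ) (G : ∀ x : M, TangentSpace (𝓡 n) x →L[ℝ] ℝ), IsW012 B v G →
    Integrable (fun x ↦ |v x| ^ (2 * (n : ℝ) / ((n : ℝ) - 2))) (riemannianVolume n M) ∧
    (∫ x, |v x| ^ (2 * (n : ℝ) / ((n : ℝ) - 2)) ∂(riemannianVolume n M))
        ^ (((n : ℝ) - 2) / (n : ℝ))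
      ≤ A * ∫ x, (‖G x‖ ^ 2 + 1 / 4 * scalarCurvature n x * v x ^ 2)
            ∂(riemannianVolume n M)
        + A * ∫ x, v x ^ 2 ∂(riemannianVolume n M)

end Coordinates

end RiemannianVolumeBound

end

/-! Write `V(ρ)` for the volume of the ball of radius `ρ` about `x₀` and `θ = (n-2)/n`. Testing the
Sobolev inequality with a cutoff that is at least `1/2` on the ball of radius `ρ/2`, supported in
the ball of radius `ρ`, with gradient at most `11/(2ρ)`, gives `ρ² / (128 A) * V(ρ/2)^θ ≤ V(ρ)`: the
curvature and `L²` terms are of order `ρ⁻²` too, because `ρ ≤ r ≤ 1`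
(`le_volume_of_perturbedSobolev`).

At the radii `r 2⁻ᵏ` this is a recursion solved with equality by `E 2⁻ⁿᵏ` for exactly one `E > 0`,
and that `E` is at least the claimed bound. The quotient `bₖ` of the volume by this solution
satisfies `bₖ₊₁^θ ≤ bₖ`. Small balls have volume at least `κ sⁿ`
(`exists_le_riemannianVolume_eball`), so `bₖ ≥ β > 0` for large `k`, whence `b₀ ≥ β^(θᵐ)` for large
`m`. This tends to `1`, so `V(r) ≥ E`, whatever the value of `κ` (`le_of_iterated_bound`).

The cutoff must be smooth, but the distance is only Lipschitz. It is mollified in charts where the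
metric is nearly constant, and the pieces are glued by a partition of unity
(`exists_isTestFunction_approx`). -/

namespace RiemannianVolumeBound

/-! ### Iteration of the nonlinear recursion. -/

section Iteration

/-- A sequence that dominates a power `θ < 1` of its shift and is eventually bounded below by a
positive constant starts at a value at least `1`. -/
lemma one_le_of_rpow_succ_le {b : ℕ → ℝ} {θ β : ℝ} {N : ℕ} (hθ0 : 0 ≤ θ) (hθ1 : θ < 1)
    (hβ : 0 < β) (hlow : ∀ k, N ≤ k → β ≤ b k) (hrec : ∀ k, b (k + 1) ^ θ ≤ b k) :
    1 ≤ b 0 := by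
  -- `m` uses of the recursion carry the bound from index `k + m` back to `k`, each costing a power
  -- `θ`.
  have key : ∀ m k : ℕ, N ≤ k + m → β ^ (θ ^ m) ≤ b k := by
    intro m
    induction m with
    | zero => intro k hk; simpa using hlow k hk
    | succ m ih =>
      intro k hk
      have h1 := ih (k + 1) (by omega)
      calc β ^ (θ ^ (m + 1)) = (β ^ (θ ^ m)) ^ θ := by
            rw [← Real.rpow_mul hβ.le, pow_succ]
        _ ≤ b (k + 1) ^ θ := Real.rpow_le_rpow (by positivity) h1 hθ0
        _ ≤ b k := hrec k
  have hlim : Filter.Tendsto (fun m : ℕ ↦ β ^ (θ ^ m)) Filter.atTop (𝓝 (β ^ (0 : ℝ))) :=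
    (Real.continuousAt_const_rpow hβ.ne').tendsto.comp
      (tendsto_pow_atTop_nhds_zero_of_lt_one hθ0 hθ1)
  rw [Real.rpow_zero] at hlim
  refine le_of_tendsto hlim ?_
  filter_upwards [Filter.eventually_ge_atTop N] with m hm using key m 0 (by simpa using hm)

/-- The bound produced by iterating `c 4⁻ᵏ aₖ₊₁^{(n-2)/n} ≤ aₖ` when `aₖ` decays at most like
`2^{-nk}`. -/
lemma le_of_iterated_bound {a : ℕ → ℝ} {n : ℕ} {c κ : ℝ} {N : ℕ} (hn : 2 < n) (hc : 0 < c)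
    (hκ : 0 < κ) (ha : ∀ k, 0 ≤ a k) (hlow : ∀ k, N ≤ k → κ * ((1 / 2 : ℝ) ^ k) ^ n ≤ a k)
    (hrec : ∀ k, c * ((1 / 2 : ℝ) ^ k) ^ 2 * a (k + 1) ^ (((n : ℝ) - 2) / n) ≤ a k) :
    c ^ ((n : ℝ) / 2) * (2 : ℝ) ^ (-((n : ℝ) * ((n : ℝ) - 2) / 2)) ≤ a 0 := by
  have hn' : (2 : ℝ) < n := by exact_mod_cast hn
  have hn0 : (0 : ℝ) < n := by linarith
  set θ : ℝ := ((n : ℝ) - 2) / n with hθ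
  -- Equality in the recursion for `E 2⁻ⁿᵏ` amounts to `E^(1-θ) = c 2^(-(n-2))`, where `1 - θ =
  -- 2/n`; `k` cancels since `nθ = n - 2`.
  set E : ℝ := c ^ ((n : ℝ) / 2) * (2 : ℝ) ^ (-((n : ℝ) * ((n : ℝ) - 2) / 2)) with hE
  have hEpos : 0 < E := by positivity
  have hpow (k : ℕ) : ((1 / 2 : ℝ) ^ k) ^ n = (2 : ℝ) ^ (-((k : ℝ) * n)) := by
    rw [Real.rpow_neg (by norm_num), ← pow_mul, one_div, inv_pow, ← Nat.cast_mul,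
      Real.rpow_natCast]
  have hEθ (k : ℕ) : c * ((1 / 2 : ℝ) ^ k) ^ 2 * (E * ((1 / 2 : ℝ) ^ (k + 1)) ^ n) ^ θ
      = E * ((1 / 2 : ℝ) ^ k) ^ n := by
    have h2 : ((1 / 2 : ℝ) ^ k) ^ 2 = (2 : ℝ) ^ (-((k : ℝ) * 2)) := by
      rw [Real.rpow_neg (by norm_num), ← pow_mul, one_div, inv_pow,
        show (k : ℝ) * 2 = ((k * 2 : ℕ) : ℝ) by push_cast; ring, Real.rpow_natCast]
    rw [hpow, hpow, h2, hE, Real.mul_rpow (by positivity) (by positivity),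
      Real.mul_rpow (by positivity) (by positivity), ← Real.rpow_mul hc.le,
      ← Real.rpow_mul (by norm_num), ← Real.rpow_mul (by norm_num)]
    have h3 : c * c ^ ((n : ℝ) / 2 * θ) = c ^ ((n : ℝ) / 2) := by
      nth_rewrite 1 [← Real.rpow_one c]
      rw [← Real.rpow_add hc]
      congr 1
      rw [hθ]; field_simp; ring
    have h4 : (2 : ℝ) ^ (-((k : ℝ) * 2)) * ((2 : ℝ) ^ (-((n : ℝ) * ((n : ℝ) - 2) / 2) * θ)
        * (2 : ℝ) ^ (-((((k + 1 : ℕ) : ℝ)) * n) * θ))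
        = (2 : ℝ) ^ (-((n : ℝ) * ((n : ℝ) - 2) / 2)) * (2 : ℝ) ^ (-((k : ℝ) * n)) := by
      rw [← Real.rpow_add (by norm_num), ← Real.rpow_add (by norm_num),
        ← Real.rpow_add (by norm_num)]
      congr 1
      rw [hθ]; push_cast; field_simp; ring
    calc _ = (c * c ^ ((n : ℝ) / 2 * θ)) * ((2 : ℝ) ^ (-((k : ℝ) * 2)) *
          ((2 : ℝ) ^ (-((n : ℝ) * ((n : ℝ) - 2) / 2) * θ)
          * (2 : ℝ) ^ (-((((k + 1 : ℕ) : ℝ)) * n) * θ))) := by ring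
      _ = _ := by rw [h3, h4]; ring
  have hone := one_le_of_rpow_succ_le (b := fun k ↦ a k / (E * ((1 / 2 : ℝ) ^ k) ^ n))
    (θ := θ) (β := κ / E) (N := N) (div_nonneg (by linarith) hn0.le)
    (by rw [hθ, div_lt_one hn0]; linarith) (by positivity) ?_ ?_
  · have := (one_le_div (by positivity)).1 hone
    simpa using this
  · intro k hk
    rw [div_le_div_iff₀ hEpos (by positivity)]
    nlinarith [hlow k hk]
  · intro k
    rw [le_div_iff₀ (by positivity), Real.div_rpow (ha _) (by positivity), ← hEθ k]
    refine le_trans (le_of_eq ?_) (hrec k)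
    have : 0 < (E * ((1 / 2 : ℝ) ^ (k + 1)) ^ n) ^ θ := by positivity
    field_simp

end Iteration

/-! ### Mollification in Euclidean space. -/

section Mollification

open Metric Set ContinuousLinearMap
open scoped Convolution

/-- A function with values in `[0, 1]` which, on an open set `W`, is `1`-Lipschitz for a seminorm
`‖D ·‖` can be approximated on a compact subset of `W` by a smooth function whose derivative is
bounded there by the same seminorm. -/
lemma exists_contDiff_approx {E F : Type*} [NormedAddCommGroup E] [NormedSpace ℝ E]
    [FiniteDimensional ℝ E] [MeasurableSpace E] [BorelSpace E]
    [SeminormedAddCommGroup F] [NormedSpace ℝ F] (D : E →L[ℝ] F) {W S : Set E} (hW : IsOpen W)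
    (hS : IsCompact S) (hSW : S ⊆ W) {f : E → ℝ} (h01 : ∀ y ∈ W, f y ∈ Icc (0 : ℝ) 1)
    (hf : ∀ y ∈ W, ∀ y' ∈ W, |f y - f y'| ≤ ‖D (y - y')‖) {ε : ℝ} (hε : 0 < ε) :
    ∃ u : E → ℝ, ContDiff ℝ ∞ u ∧ (∀ y, u y ∈ Icc (0 : ℝ) 1) ∧
      ∀ y ∈ S, |u y - f y| ≤ ε ∧ ∀ w, |fderiv ℝ u y w| ≤ ‖D w‖ := by
  let μ : Measure E := Measure.addHaar
  obtain ⟨δ₀, hδ₀, hδ₀W⟩ := hS.exists_cthickening_subset_open hW hSW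
  -- The first entry keeps points of `S` in `W` after two displacements of size below `δ`; the
  -- second makes the oscillation of `f` at scale `δ` at most `ε`.
  set δ : ℝ := min (δ₀ / 3) (ε / (‖D‖ + 1)) with hδ
  have hDpos : 0 < ‖D‖ + 1 := by positivity
  have hδpos : 0 < δ := lt_min (by positivity) (by positivity)
  have hδ1 : δ ≤ δ₀ / 3 := min_le_left _ _
  have hδ2 : ‖D‖ * δ ≤ ε := by
    have : δ ≤ ε / (‖D‖ + 1) := min_le_right _ _
    rw [le_div_iff₀ hDpos] at this
    nlinarith
  have hmem : ∀ y ∈ S, ∀ z, ‖z - y‖ < 2 * δ → z ∈ W := by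
    intro y hy z hz
    refine hδ₀W (mem_cthickening_of_dist_le z y δ₀ S hy ?_)
    rw [dist_eq_norm]; linarith
  let g : E → ℝ := W.indicator f
  have hg01 : ∀ y, g y ∈ Icc (0 : ℝ) 1 := by
    intro y
    by_cases hy : y ∈ W
    · simpa [g, hy] using h01 y hy
    · simp [g, hy]
  have hgW : ∀ y ∈ W, g y = f y := fun y hy ↦ by simp [g, hy]
  have hfc : ContinuousOn f W := by
    intro y hy
    rw [ContinuousWithinAt, tendsto_iff_dist_tendsto_zero]
    have h0 : Filter.Tendsto (fun z ↦ ‖D (z - y)‖) (𝓝[W] y) (𝓝 0) := by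
      have : Continuous (fun z ↦ ‖D (z - y)‖) := by fun_prop
      simpa using (this.tendsto y).mono_left nhdsWithin_le_nhds
    refine squeeze_zero' (Filter.Eventually.of_forall fun _ ↦ dist_nonneg) ?_ h0
    filter_upwards [self_mem_nhdsWithin] with z hz
    rw [Real.dist_eq]
    exact hf z hz y hy
  have hgm : AEStronglyMeasurable g μ :=
    (aestronglyMeasurable_indicator_iff hW.measurableSet).2
      (hfc.aestronglyMeasurable hW.measurableSet)
  have hgi : LocallyIntegrable g μ := by
    refine (memLp_top_of_bound hgm 1 (Filter.Eventually.of_forall fun y ↦ ?_)).locallyIntegrable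
      le_top
    rw [Real.norm_eq_abs, abs_le]
    exact ⟨by linarith [(hg01 y).1], (hg01 y).2⟩
  let φ : ContDiffBump (0 : E) := ⟨δ / 2, δ, by positivity, by linarith⟩
  let u : E → ℝ := φ.normed μ ⋆[lsmul ℝ ℝ, μ] g
  have hex : ∀ y, Integrable (fun t ↦ φ.normed μ t * g (y - t)) μ := fun y ↦
    (φ.hasCompactSupport_normed.convolutionExists_left (lsmul ℝ ℝ) φ.continuous_normed hgi y)
  have hu : ∀ y, u y = ∫ t, φ.normed μ t * g (y - t) ∂μ := fun y ↦ rfl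
  have husm : ContDiff ℝ ∞ u :=
    φ.hasCompactSupport_normed.contDiff_convolution_left _ φ.contDiff_normed hgi
  have hφint : Integrable (φ.normed μ) μ := φ.integrable_normed
  -- `u` averages translates of `g`, and the seminorm `‖D ·‖` is the same at every point, so no
  -- constant is lost.
  have hlip : ∀ y ∈ S, ∀ y', ‖y' - y‖ < δ → |u y' - u y| ≤ ‖D (y' - y)‖ := by
    intro y hy y' hy'
    rw [hu, hu, ← integral_sub (hex y') (hex y)]
    have hb : ∀ t, ‖φ.normed μ t * g (y' - t) - φ.normed μ t * g (y - t)‖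
        ≤ φ.normed μ t * ‖D (y' - y)‖ := by
      intro t
      rw [← mul_sub, norm_mul, Real.norm_of_nonneg (φ.nonneg_normed t)]
      by_cases ht : t ∈ Function.support (φ.normed μ)
      · rw [φ.support_normed_eq] at ht
        have ht' : ‖t‖ < δ := by simpa [φ] using ht
        have h1 : y - t ∈ W := hmem y hy _ (by
          rw [sub_sub_cancel_left, norm_neg]; linarith)
        have h2 : y' - t ∈ W := hmem y hy _ (by
          calc ‖y' - t - y‖ = ‖(y' - y) - t‖ := by congr 1; abel
            _ ≤ ‖y' - y‖ + ‖t‖ := norm_sub_le _ _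
            _ < 2 * δ := by linarith)
        rw [hgW _ h1, hgW _ h2]
        gcongr
        · exact φ.nonneg_normed t
        · have := hf _ h2 _ h1
          rwa [sub_sub_sub_cancel_right] at this
      · rw [Function.notMem_support.1 ht]; simp
    refine (norm_integral_le_of_norm_le (hφint.mul_const _)
      (Filter.Eventually.of_forall hb)).trans ?_
    rw [integral_mul_const, φ.integral_normed, one_mul]
  refine ⟨u, husm, fun y ↦ ⟨?_, ?_⟩, fun y hy ↦ ⟨?_, fun w ↦ ?_⟩⟩
  · rw [hu]
    exact integral_nonneg fun t ↦ mul_nonneg (φ.nonneg_normed t) (hg01 _).1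
  · rw [hu, ← φ.integral_normed (μ := μ)]
    exact integral_mono (hex y) hφint fun t ↦
      mul_le_of_le_one_right (φ.nonneg_normed t) (hg01 _).2
  · have hyW : y ∈ W := hSW hy
    rw [← hgW y hyW, ← Real.dist_eq]
    refine φ.dist_normed_convolution_le hgm fun z hz ↦ ?_
    have hz' : ‖z - y‖ < δ := by simpa [φ, dist_eq_norm] using hz
    have hzW : z ∈ W := hmem y hy z (by linarith)
    rw [Real.dist_eq, hgW _ hzW, hgW _ hyW]
    refine (hf z hzW y hyW).trans ((D.le_opNorm _).trans ?_)
    nlinarith [norm_nonneg D]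
  · have hd : HasDerivAt (fun t : ℝ ↦ u (y + t • w)) (fderiv ℝ u y w) 0 := by
      have h1 : HasFDerivAt u (fderiv ℝ u y) (y + (0 : ℝ) • w) := by
        simpa using (husm.differentiable (by simp) y).hasFDerivAt
      have h2 : HasDerivAt (fun t : ℝ ↦ y + t • w) w 0 := by
        simpa using ((hasDerivAt_id (0 : ℝ)).smul_const w).const_add y
      exact h1.comp_hasDerivAt (0 : ℝ) h2
    refine hd.le_of_lip' (norm_nonneg _) ?_
    have hsmall : ∀ᶠ t in 𝓝 (0 : ℝ), ‖(y + t • w) - y‖ < δ := by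
      have : Continuous fun t : ℝ ↦ ‖(y + t • w) - y‖ := by fun_prop
      exact this.continuousAt.eventually_lt_const (by simpa using hδpos)
    filter_upwards [hsmall] with t ht
    have := hlip y hy _ ht
    rw [Real.norm_eq_abs, zero_smul, add_zero, sub_zero, mul_comm, ← norm_smul, ← map_smul]
    simpa using this

end Mollification

/-! ### Comparison of the metric with a constant one in a chart. -/

section Charts

open Metric Set Manifold

variable {n : ℕ} {M : Type*} [EMetricSpace M]
  [ChartedSpace (EuclideanSpace ℝ (Fin n)) M] [IsManifold (𝓡 n) ∞ M]

variable (n) in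
/-- The vector at `x` with coordinates `w` in the preferred chart at `c`. -/
noncomputable def ofCoord (c x : M) : EuclideanSpace ℝ (Fin n) →L[ℝ] TangentSpace (𝓡 n) x :=
  (trivializationAt (EuclideanSpace ℝ (Fin n)) (fun x : M ↦ TangentSpace (𝓡 n) x) c).symmL ℝ x

variable (n) in
/-- The coordinates in the preferred chart at `c` of a vector at `x`. -/
noncomputable def toCoord (c x : M) : TangentSpace (𝓡 n) x →L[ℝ] EuclideanSpace ℝ (Fin n) :=
  (trivializationAt (EuclideanSpace ℝ (Fin n))
    (fun x : M ↦ TangentSpace (𝓡 n) x) c).continuousLinearMapAt ℝ x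

lemma toCoord_ofCoord (c : M) {x : M} (hx : x ∈ (extChartAt (𝓡 n) c).source)
    (w : EuclideanSpace ℝ (Fin n)) : toCoord n c x (ofCoord n c x w) = w := by
  rw [toCoord, ofCoord]
  exact Trivialization.continuousLinearMapAt_symmL _ (by simpa using hx) w

lemma mfderiv_extChartAt_symm_eq (c : M) {y : EuclideanSpace ℝ (Fin n)}
    (hy : y ∈ (extChartAt (𝓡 n) c).target) (w : EuclideanSpace ℝ (Fin n)) :
    mfderiv (𝓡 n) (𝓡 n) (extChartAt (𝓡 n) c).symm y w
      = ofCoord n c ((extChartAt (𝓡 n) c).symm y) w := by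
  have hx : (extChartAt (𝓡 n) c).symm y ∈ (chartAt (EuclideanSpace ℝ (Fin n)) c).source := by
    simpa using (extChartAt (𝓡 n) c).map_target hy
  have h := TangentBundle.symmL_trivializationAt (𝕜 := ℝ) (I := 𝓡 n) hx
  rw [(extChartAt (𝓡 n) c).right_inv hy, ModelWithCorners.range_eq_univ, mfderivWithin_univ] at h
  rw [ofCoord, h]
  rfl

lemma mfderiv_extChartAt_eq (c : M) {x : M} (hx : x ∈ (extChartAt (𝓡 n) c).source)
    (v : TangentSpace (𝓡 n) x) :
    mfderiv (𝓡 n) (𝓡 n) (extChartAt (𝓡 n) c) x v = toCoord n c x v := by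
  have hx' : x ∈ (chartAt (EuclideanSpace ℝ (Fin n)) c).source := by simpa using hx
  rw [toCoord, TangentBundle.continuousLinearMapAt_trivializationAt (𝕜 := ℝ) (I := 𝓡 n) hx']
  rfl

lemma differential_comp_extChartAt (c : M) {u : EuclideanSpace ℝ (Fin n) → ℝ}
    {x : M} (hu : MDifferentiableAt (𝓡 n) 𝓘(ℝ, ℝ) u (extChartAt (𝓡 n) c x))
    (hx : x ∈ (extChartAt (𝓡 n) c).source)
    (v : TangentSpace (𝓡 n) x) :
    differential n (fun z ↦ u (extChartAt (𝓡 n) c z)) x v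
      = fderiv ℝ u (extChartAt (𝓡 n) c x) (toCoord n c x v) := by
  have hx' : x ∈ (chartAt (EuclideanSpace ℝ (Fin n)) c).source := by simpa using hx
  have h2 : MDifferentiableAt (𝓡 n) (𝓡 n) (extChartAt (𝓡 n) c) x :=
    mdifferentiableAt_extChartAt hx'
  have h3 := mfderiv_comp x hu h2
  rw [← mfderiv_extChartAt_eq c hx, ← mfderiv_eq_fderiv]
  exact congrArg (fun L ↦ L v) h3

variable [RiemannianBundle (fun x : M ↦ TangentSpace (𝓡 n) x)]

/-- The distance is an infimum of lengths, and the image of the coordinate segment is a competitor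
whose speed is controlled by `hK`. -/
lemma edist_extChartAt_symm_le [IsRiemannianManifold (𝓡 n) M] (c : M)
    {s : Set (EuclideanSpace ℝ (Fin n))} (hs : Convex ℝ s)
    (hst : s ⊆ (extChartAt (𝓡 n) c).target) {K : ℝ}
    (hK : ∀ y ∈ s, ∀ w, ‖ofCoord n c ((extChartAt (𝓡 n) c).symm y) w‖ ≤ K * ‖ofCoord n c c w‖)
    {y y' : EuclideanSpace ℝ (Fin n)} (hy : y ∈ s) (hy' : y' ∈ s) :
    edist ((extChartAt (𝓡 n) c).symm y) ((extChartAt (𝓡 n) c).symm y')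
      ≤ ENNReal.ofReal (K * ‖ofCoord n c c (y' - y)‖) := by
  rw [IsRiemannianManifold.out (I := 𝓡 n)]
  let η : ℝ → EuclideanSpace ℝ (Fin n) := fun t ↦ AffineMap.lineMap y y' t
  let γ : ℝ → M := (extChartAt (𝓡 n) c).symm ∘ η
  have hη : ∀ t ∈ Icc (0 : ℝ) 1, η t ∈ s := by
    intro t ht
    refine hs.segment_subset hy hy' ?_
    rw [segment_eq_image_lineMap]
    exact ⟨t, ht, rfl⟩
  have hηd : ∀ t, HasDerivAt η (y' - y) t := fun t ↦ AffineMap.hasDerivAt_lineMap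
  have hηs : ContMDiff 𝓘(ℝ, ℝ) (𝓡 n) 1 η := by
    rw [contMDiff_iff_contDiff]
    exact (ContinuousAffineMap.lineMap (R := ℝ) y y').contDiff
  have hγ : riemannianEDist (𝓡 n) ((extChartAt (𝓡 n) c).symm y) ((extChartAt (𝓡 n) c).symm y')
      ≤ pathELength (𝓡 n) γ 0 1 := by
    apply riemannianEDist_le_pathELength _ _ _ zero_le_one
    · exact (contMDiffOn_extChartAt_symm (n := 1) c).comp hηs.contMDiffOn
        fun t ht ↦ hst (hη t ht)
    · simp [γ, η]
    · simp [γ, η]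
  refine hγ.trans ?_
  rw [pathELength_eq_lintegral_mfderiv_Icc]
  have hpt : ∀ t ∈ Icc (0 : ℝ) 1, ‖mfderiv 𝓘(ℝ, ℝ) (𝓡 n) γ t 1‖ₑ
      ≤ ENNReal.ofReal (K * ‖ofCoord n c c (y' - y)‖) := by
    intro t ht
    have hst' := hst (hη t ht)
    have h1 : MDifferentiableAt (𝓡 n) (𝓡 n) (extChartAt (𝓡 n) c).symm (η t) := by
      have := mdifferentiableWithinAt_extChartAt_symm (I := 𝓡 n) hst'
      rwa [ModelWithCorners.range_eq_univ, mdifferentiableWithinAt_univ] at this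
    have h2 : MDifferentiableAt 𝓘(ℝ, ℝ) (𝓡 n) η t := hηs.mdifferentiable one_ne_zero t
    have h3 : mfderiv 𝓘(ℝ, ℝ) (𝓡 n) γ t =
        (mfderiv (𝓡 n) (𝓡 n) (extChartAt (𝓡 n) c).symm (η t)).comp
        (mfderiv 𝓘(ℝ, ℝ) (𝓡 n) η t) := mfderiv_comp t h1 h2
    have h4 : mfderiv 𝓘(ℝ, ℝ) (𝓡 n) η t (1 : ℝ) = y' - y := by
      rw [mfderiv_eq_fderiv]
      rw [(hηd t).hasFDerivAt.fderiv]
      exact one_smul ℝ (y' - y)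
    have h5 : mfderiv 𝓘(ℝ, ℝ) (𝓡 n) γ t (1 : ℝ)
        = ofCoord n c ((extChartAt (𝓡 n) c).symm (η t)) (y' - y) := by
      rw [h3, ← mfderiv_extChartAt_symm_eq c hst', ← h4]
      rfl
    rw [← ofReal_norm]
    refine ENNReal.ofReal_le_ofReal ?_
    refine le_trans (le_of_eq ?_) (hK _ (hη t ht) (y' - y))
    exact congrArg norm h5
  refine (setLIntegral_mono' measurableSet_Icc hpt).trans ?_
  simp

variable [IsContMDiffRiemannianBundle (𝓡 n) ∞ (EuclideanSpace ℝ (Fin n))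
    (fun x : M ↦ TangentSpace (𝓡 n) x)]

variable (n M) in
lemma isContinuousRiemannianBundle_tangentSpace :
    IsContinuousRiemannianBundle (EuclideanSpace ℝ (Fin n))
      (fun x : M ↦ TangentSpace (𝓡 n) x) := by
  obtain ⟨g, g_smooth, hg⟩ := IsContMDiffRiemannianBundle.exists_contMDiff (IB := 𝓡 n) (n := ∞)
    (F := EuclideanSpace ℝ (Fin n)) (E := fun x : M ↦ TangentSpace (𝓡 n) x)
  exact ⟨g, g_smooth.continuous, hg⟩

/-- Near the centre of a chart, the metric is almost the constant metric at the centre. -/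
lemma exists_ball_metric_comparison (c : M) {K : ℝ} (hK : 1 < K) :
    ∃ δ > 0, ∃ C > 0, ball (extChartAt (𝓡 n) c c) δ ⊆ (extChartAt (𝓡 n) c).target ∧
      ∀ x ∈ (extChartAt (𝓡 n) c).source, extChartAt (𝓡 n) c x ∈ ball (extChartAt (𝓡 n) c c) δ →
        (∀ w, ‖ofCoord n c x w‖ ≤ K * ‖ofCoord n c c w‖) ∧
        (∀ v, ‖ofCoord n c c (toCoord n c x v)‖ ≤ K * ‖v‖) ∧
        (∀ v, ‖toCoord n c x v‖ ≤ C * ‖v‖) := by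
  have := isContinuousRiemannianBundle_tangentSpace n M
  obtain ⟨C, hC, h3⟩ := eventually_norm_trivializationAt_lt
    (EuclideanSpace ℝ (Fin n)) (fun x : M ↦ TangentSpace (𝓡 n) x) c
  have h1 := eventually_norm_symmL_trivializationAt_comp_self_lt
    (EuclideanSpace ℝ (Fin n)) (fun x : M ↦ TangentSpace (𝓡 n) x) c hK
  have h2 := eventually_norm_symmL_trivializationAt_self_comp_lt
    (EuclideanSpace ℝ (Fin n)) (fun x : M ↦ TangentSpace (𝓡 n) x) c hK
  set Q : M → Prop := fun x ↦ (∀ w, ‖ofCoord n c x w‖ ≤ K * ‖ofCoord n c c w‖) ∧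
    (∀ v, ‖ofCoord n c c (toCoord n c x v)‖ ≤ K * ‖v‖) ∧ (∀ v, ‖toCoord n c x v‖ ≤ C * ‖v‖)
  have hall : ∀ᶠ x in 𝓝 c, Q x := by
    filter_upwards [h1, h2, h3] with x g1 g2 g3
    refine ⟨fun w ↦ ?_, fun v ↦ ?_, fun v ↦ ?_⟩
    · have := ContinuousLinearMap.le_of_opNorm_le _ g1.le (ofCoord n c c w)
      rw [ContinuousLinearMap.comp_apply] at this
      have e := toCoord_ofCoord c (mem_extChartAt_source (I := 𝓡 n) c) w
      rw [toCoord] at e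
      rwa [e] at this
    · exact ContinuousLinearMap.le_of_opNorm_le _ g2.le v
    · exact ContinuousLinearMap.le_of_opNorm_le _ g3.le v
  have hcont : Filter.Tendsto (extChartAt (𝓡 n) c).symm (𝓝 (extChartAt (𝓡 n) c c)) (𝓝 c) := by
    have := continuousAt_extChartAt_symm (I := 𝓡 n) c
    rwa [ContinuousAt, extChartAt_to_inv] at this
  obtain ⟨δ, hδ, hball⟩ := Metric.mem_nhds_iff.1
    (Filter.inter_mem (extChartAt_target_mem_nhds (I := 𝓡 n) c) (hcont.eventually hall))
  refine ⟨δ, hδ, C, hC, fun y hy ↦ (hball hy).1, fun x hx hxb ↦ ?_⟩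
  have h : Q ((extChartAt (𝓡 n) c).symm (extChartAt (𝓡 n) c x)) := (hball hxb).2
  rwa [(extChartAt (𝓡 n) c).left_inv hx] at h

end Charts

/-! ### Smooth approximation of Lipschitz functions on the manifold. -/

section Cutoff

open Metric Set Manifold
open scoped NNReal

variable {n : ℕ} {M : Type*} [EMetricSpace M]
  [ChartedSpace (EuclideanSpace ℝ (Fin n)) M]

lemma differential_mul_apply {f g : M → ℝ} {x : M} (hf : MDifferentiableAt (𝓡 n) 𝓘(ℝ, ℝ) f x)
    (hg : MDifferentiableAt (𝓡 n) 𝓘(ℝ, ℝ) g x) (w : TangentSpace (𝓡 n) x) :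
    differential n (fun z ↦ f z * g z) x w
      = f x * differential n g x w + g x * differential n f x w :=
  congrArg (fun L ↦ L w) (hf.hasMFDerivAt.mul hg.hasMFDerivAt).mfderiv

lemma differential_apply_eq_zero {f : M → ℝ} {x : M} {a : ℝ} (hf : f =ᶠ[𝓝 x] fun _ ↦ a)
    (w : TangentSpace (𝓡 n) x) : differential n f x w = 0 := by
  rw [differential, hf.mfderiv_eq, mfderiv_const]
  rfl

lemma differential_sum_apply {ι : Type*} {t : Finset ι} {f : ι → M → ℝ} {x : M}
    (hf : ∀ i ∈ t, MDifferentiableAt (𝓡 n) 𝓘(ℝ, ℝ) (f i) x) (w : TangentSpace (𝓡 n) x) :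
    differential n (fun z ↦ ∑ i ∈ t, f i z) x w = ∑ i ∈ t, differential n (f i) x w := by
  classical
  suffices h : MDifferentiableAt (𝓡 n) 𝓘(ℝ, ℝ) (fun z ↦ ∑ i ∈ t, f i z) x ∧
      differential n (fun z ↦ ∑ i ∈ t, f i z) x w = ∑ i ∈ t, differential n (f i) x w from h.2
  induction t using Finset.induction_on with
  | empty =>
    simp only [Finset.sum_empty]
    exact ⟨mdifferentiableAt_const, differential_apply_eq_zero (a := 0) Filter.EventuallyEq.rfl w⟩
  | insert a s ha ih =>
    simp only [Finset.sum_insert ha]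
    obtain ⟨h1, h2⟩ := ih fun i hi ↦ hf i (Finset.mem_insert_of_mem hi)
    have h3 := (hf a (Finset.mem_insert_self a s)).hasMFDerivAt.add h1.hasMFDerivAt
    exact ⟨h3.mdifferentiableAt, (congrArg (fun L ↦ L w) h3.mfderiv).trans (by rw [← h2]; rfl)⟩

variable [IsManifold (𝓡 n) ∞ M] [RiemannianBundle (fun x : M ↦ TangentSpace (𝓡 n) x)]
  [IsContMDiffRiemannianBundle (𝓡 n) ∞ (EuclideanSpace ℝ (Fin n))
    (fun x : M ↦ TangentSpace (𝓡 n) x)]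

/-- The differential of a smooth function is bounded on compact sets. -/
lemma exists_norm_differential_le {f : M → ℝ} (hf : ContMDiff (𝓡 n) 𝓘(ℝ, ℝ) ∞ f) {S : Set M}
    (hS : IsCompact S) : ∃ C, ∀ x ∈ S, ‖differential n f x‖ ≤ C := by
  refine hS.induction_on (p := fun S ↦ ∃ C, ∀ x ∈ S, ‖differential n f x‖ ≤ C) ⟨0, by simp⟩
    (fun s t hst ⟨C, hC⟩ ↦ ⟨C, fun x hx ↦ hC x (hst hx)⟩)
    (fun s t ⟨C, hC⟩ ⟨C', hC'⟩ ↦ ⟨max C C', ?_⟩) fun c _ ↦ ?_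
  · rintro x (hx | hx)
    exacts [(hC x hx).trans (le_max_left _ _), (hC' x hx).trans (le_max_right _ _)]
  obtain ⟨δ, hδ, C, hC, hball, hcomp⟩ := exists_ball_metric_comparison (n := n) c one_lt_two
  let g : EuclideanSpace ℝ (Fin n) → ℝ := f ∘ (extChartAt (𝓡 n) c).symm
  have hg : ContDiffOn ℝ ∞ g (ball (extChartAt (𝓡 n) c c) δ) := by
    rw [← contMDiffOn_iff_contDiffOn]
    exact hf.comp_contMDiffOn ((contMDiffOn_extChartAt_symm c).mono hball)
  have hgc : ContinuousAt (fun y ↦ ‖fderiv ℝ g y‖) (extChartAt (𝓡 n) c c) :=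
    ((hg.continuousOn_fderiv_of_isOpen isOpen_ball (by simp)).continuousAt
      (isOpen_ball.mem_nhds (mem_ball_self hδ))).norm
  have h1 := hgc.eventually_lt_const (lt_add_one _)
  have h2 := (isOpen_ball.mem_nhds (mem_ball_self hδ) : ball (extChartAt (𝓡 n) c c) δ ∈ 𝓝 _)
  have h3 := (continuousAt_extChartAt (I := 𝓡 n) c).eventually (h1.and h2)
  set B : ℝ := ‖fderiv ℝ g (extChartAt (𝓡 n) c c)‖ + 1
  refine ⟨_, mem_nhdsWithin_of_mem_nhds
    (Filter.inter_mem h3 (extChartAt_source_mem_nhds (I := 𝓡 n) c)), B * C, ?_⟩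
  rintro x ⟨⟨hxB, hxball⟩, hxs⟩
  have hx' : x ∈ (chartAt (EuclideanSpace ℝ (Fin n)) c).source := by simpa using hxs
  have hB : 0 ≤ B := by positivity
  refine ContinuousLinearMap.opNorm_le_bound _ (by positivity) fun v ↦ ?_
  have heq : f =ᶠ[𝓝 x] fun z ↦ g (extChartAt (𝓡 n) c z) := by
    filter_upwards [extChartAt_source_mem_nhds' (I := 𝓡 n) hxs] with z hz
    simp only [g, Function.comp_apply, (extChartAt (𝓡 n) c).left_inv hz]
  have hgd : MDifferentiableAt (𝓡 n) 𝓘(ℝ, ℝ) g (extChartAt (𝓡 n) c x) :=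
    ((hg.differentiableOn (by simp)).differentiableAt
      (isOpen_ball.mem_nhds hxball)).mdifferentiableAt
  have hd : differential n f x v = fderiv ℝ g (extChartAt (𝓡 n) c x) (toCoord n c x v) := by
    rw [differential, heq.mfderiv_eq]
    exact differential_comp_extChartAt c hgd hxs v
  rw [hd]
  calc _ ≤ ‖fderiv ℝ g (extChartAt (𝓡 n) c x)‖ * ‖toCoord n c x v‖ :=
        ContinuousLinearMap.le_opNorm _ _
    _ ≤ B * (C * ‖v‖) :=
        mul_le_mul (le_of_lt hxB) ((hcomp x hxs hxball).2.2 v) (norm_nonneg _) hB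
    _ = B * C * ‖v‖ := by ring

variable [IsRiemannianManifold (𝓡 n) M]

/-- Local smooth approximation of Lipschitz functions with control of the differential. -/
lemma exists_nhds_smooth_approx (c : M) {K : ℝ} (hK : 1 < K) :
    ∃ U ∈ 𝓝 c, ∀ S ⊆ U, IsCompact S → ∀ f : M → ℝ, (∀ x, f x ∈ Icc (0 : ℝ) 1) →
      ∀ L : ℝ≥0, LipschitzWith L f → ∀ ε > 0, ∃ v : M → ℝ,
        (∀ x, v x ∈ Icc (0 : ℝ) 1) ∧ ∀ x ∈ S, ContMDiffAt (𝓡 n) 𝓘(ℝ, ℝ) ∞ v x ∧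
          |v x - f x| ≤ ε ∧ ‖differential n v x‖ ≤ K ^ 2 * L := by
  obtain ⟨δ, hδ, C, hC, hball, hcomp⟩ := exists_ball_metric_comparison (n := n) c hK
  have hU : (extChartAt (𝓡 n) c).source ∩
      extChartAt (𝓡 n) c ⁻¹' ball (extChartAt (𝓡 n) c c) δ ∈ 𝓝 c :=
    Filter.inter_mem (extChartAt_source_mem_nhds (I := 𝓡 n) c)
      ((continuousAt_extChartAt (I := 𝓡 n) c).preimage_mem_nhds (ball_mem_nhds _ hδ))
  refine ⟨_, hU, fun S hSU hS f hf01 L hL ε hε ↦ ?_⟩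
  have hSs : S ⊆ (extChartAt (𝓡 n) c).source := fun x hx ↦ (hSU hx).1
  have hS' : IsCompact (extChartAt (𝓡 n) c '' S) :=
    hS.image_of_continuousOn ((continuousOn_extChartAt c).mono hSs)
  have hK0 : 0 ≤ K := by linarith
  have hcomp' : ∀ y ∈ ball (extChartAt (𝓡 n) c c) δ, ∀ w,
      ‖ofCoord n c ((extChartAt (𝓡 n) c).symm y) w‖ ≤ K * ‖ofCoord n c c w‖ := by
    intro y hy
    refine (hcomp _ ((extChartAt (𝓡 n) c).map_target (hball hy)) ?_).1
    rwa [(extChartAt (𝓡 n) c).right_inv (hball hy)]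
  -- In coordinates `f` is Lipschitz for `L * K` times the constant metric at `c`; returning to the
  -- metric at `x` costs the second factor `K`.
  obtain ⟨u, hu, hu01, huS⟩ := exists_contDiff_approx ((L * K) • ofCoord n c c) isOpen_ball hS'
    (image_subset_iff.2 fun x hx ↦ (hSU hx).2) (f := f ∘ (extChartAt (𝓡 n) c).symm)
    (fun y _ ↦ hf01 _) (fun y hy y' hy' ↦ by
      have h1 := hL ((extChartAt (𝓡 n) c).symm y') ((extChartAt (𝓡 n) c).symm y)
      have h2 := edist_extChartAt_symm_le c (convex_ball _ _) hball hcomp' hy' hy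
      have h3 := h1.trans (mul_le_mul_right h2 _)
      rw [edist_dist, ← ENNReal.ofReal_coe_nnreal, ← ENNReal.ofReal_mul L.coe_nonneg] at h3
      have h4 := (ENNReal.ofReal_le_ofReal_iff (by positivity)).1 h3
      rw [dist_comm, Real.dist_eq] at h4
      refine h4.trans (le_of_eq ?_)
      rw [smul_apply, norm_smul, Real.norm_of_nonneg (by positivity), mul_assoc])
    hε
  refine ⟨fun x ↦ u (extChartAt (𝓡 n) c x), fun x ↦ hu01 _, fun x hx ↦ ?_⟩
  obtain ⟨h1, h2⟩ := huS _ (mem_image_of_mem _ hx)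
  have hx' : x ∈ (chartAt (EuclideanSpace ℝ (Fin n)) c).source := by simpa using hSs hx
  refine ⟨hu.contMDiff.contMDiffAt.comp x (contMDiffAt_extChartAt' hx'), ?_, ?_⟩
  · rwa [Function.comp_apply, (extChartAt (𝓡 n) c).left_inv (hSs hx)] at h1
  · refine ContinuousLinearMap.opNorm_le_bound _ (by positivity) fun v ↦ ?_
    rw [differential_comp_extChartAt c (hu.differentiable (by simp) _).mdifferentiableAt (hSs hx)]
    refine (h2 _).trans ?_
    rw [smul_apply, norm_smul, Real.norm_of_nonneg (by positivity)]
    calc _ ≤ L * K * (K * ‖v‖) := by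
          gcongr
          exact (hcomp x (hSs hx) (hSU hx).2).2.1 v
      _ = K ^ 2 * L * ‖v‖ := by ring

/-- Smooth approximation, by test functions, of Lipschitz functions supported in the interior of a
compact set, with control of the differential. -/
lemma exists_isTestFunction_approx [SecondCountableTopology M] {B S : Set M} (hB : IsOpen B)
    (hS : IsCompact S) (hSB : S ⊆ B) {f : M → ℝ} (hf01 : ∀ x, f x ∈ Icc (0 : ℝ) 1)
    (hfS : ∀ x, f x ≠ 0 → x ∈ interior S) {L : ℝ≥0} (hL : LipschitzWith L f) {K : ℝ} (hK : 1 < K)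
    {ε : ℝ} (hε : 0 < ε) :
    ∃ φ : M → ℝ, IsTestFunction n B φ ∧ ∀ x, φ x ∈ Icc (0 : ℝ) 1 ∧ |φ x - f x| ≤ ε ∧
      ‖differential n φ x‖ ≤ K ^ 2 * L + ε := by
  have : LocallyCompactSpace M :=
    ChartedSpace.locallyCompactSpace (EuclideanSpace ℝ (Fin n)) M
  choose U hU hUapp using fun c : M ↦ exists_nhds_smooth_approx (n := n) c hK
  have hV : ∀ c : M, ∃ V : Set M, IsCompact V ∧ (c ∈ B → c ∈ interior V ∧ V ⊆ U c ∩ B) := by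
    intro c
    by_cases hc : c ∈ B
    · obtain ⟨V, hV, hcV, hVU⟩ := exists_compact_subset (isOpen_interior.inter hB)
        (⟨mem_interior_iff_mem_nhds.2 (hU c), hc⟩ : c ∈ interior (U c) ∩ B)
      exact ⟨V, hV, fun _ ↦ ⟨hcV, hVU.trans (inter_subset_inter_left _ interior_subset)⟩⟩
    · exact ⟨∅, isCompact_empty, fun h ↦ absurd h hc⟩
  choose V hVc hVB using hV
  obtain ⟨t, htS, htcover⟩ := hS.elim_nhds_subcover (fun c ↦ interior (V c))
    fun c hc ↦ isOpen_interior.mem_nhds (hVB c (hSB hc)).1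
  obtain ⟨ψ, hψ⟩ := SmoothPartitionOfUnity.exists_isSubordinate (𝓡 n) hS.isClosed
    (fun c : t ↦ interior (V c)) (fun c ↦ isOpen_interior)
    (fun x hx ↦ by
      obtain ⟨c, hc, hxc⟩ := mem_iUnion₂.1 (htcover hx)
      exact mem_iUnion.2 ⟨⟨c, hc⟩, hxc⟩)
  have hψV : ∀ c : t, tsupport (ψ c) ⊆ V c := fun c ↦ (hψ c).trans interior_subset
  have hVUB : ∀ c : t, V c ⊆ U c ∩ B := fun c ↦ (hVB c (hSB (htS c c.2))).2
  have hψs : ∀ c : t, ContMDiff (𝓡 n) 𝓘(ℝ, ℝ) ∞ (ψ c) := fun c ↦ (ψ c).contMDiff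
  choose C hC using fun c : t ↦ exists_norm_differential_le (hψs c) (hVc c)
  -- The local errors get multiplied by the differentials of the partition functions, so they are
  -- scaled by the bounds `C c` beforehand.
  set ε' : ℝ := ε / (1 + ∑ c, |C c|) with hε'
  have hsum0 : 0 ≤ ∑ c, |C c| := Finset.sum_nonneg fun c _ ↦ abs_nonneg _
  have hε'pos : 0 < ε' := by positivity
  have hε'sum : ε' * (1 + ∑ c, |C c|) = ε := by rw [hε']; field_simp
  have hε'le : ε' ≤ ε := by nlinarith
  choose v hv01 hv using fun c : t ↦ hUapp c (V c) ((hVUB c).trans inter_subset_left) (hVc c) f hf01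
    L hL ε' hε'pos
  have hψ1 : ∀ x, ∑ c, ψ c x ≤ 1 := fun x ↦ by
    simpa only [finsum_eq_sum_of_fintype] using ψ.sum_le_one x
  have hψeq : ∀ x ∈ S, ∑ c, ψ c x = 1 := fun x hx ↦ by
    simpa only [finsum_eq_sum_of_fintype] using ψ.sum_eq_one hx
  have hfψ : ∀ x, f x = ∑ c, ψ c x * f x := fun x ↦ by
    rw [← Finset.sum_mul]
    by_cases hx : f x = 0
    · simp [hx]
    · rw [hψeq x (interior_subset (hfS x hx)), one_mul]
  have hsm : ∀ c : t, ContMDiff (𝓡 n) 𝓘(ℝ, ℝ) ∞ fun x ↦ ψ c x * v c x := fun c ↦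
    ψ.contMDiff_smul fun x hx ↦ (hv c x (hψV c hx)).1
  -- By the product rule the difference is `ψ dv + (v - f) dψ`. The subtracted terms `f dψ` sum to
  -- zero, as `hzero` shows below.
  have hd : ∀ (x : M) (w : TangentSpace (𝓡 n) x) (c : t),
      |differential n (fun z ↦ ψ c z * v c z) x w - f x * differential n (ψ c) x w|
        ≤ (ψ c x * (K ^ 2 * L) + ε' * |C c|) * ‖w‖ := by
    intro x w c
    have hψ0 := ψ.nonneg c x
    by_cases hx : x ∈ tsupport (ψ c)
    · obtain ⟨h1, h2, h3⟩ := hv c x (hψV c hx)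
      rw [differential_mul_apply ((hψs c).mdifferentiable (by simp) x)
        (h1.mdifferentiableAt (by simp)), add_sub_assoc, ← sub_mul]
      refine (abs_add_le _ _).trans ?_
      rw [abs_mul, abs_mul, abs_of_nonneg hψ0]
      have h4 : |differential n (v c) x w| ≤ K ^ 2 * L * ‖w‖ :=
        ContinuousLinearMap.le_of_opNorm_le _ h3 w
      have h5 : |differential n (ψ c) x w| ≤ |C c| * ‖w‖ :=
        ContinuousLinearMap.le_of_opNorm_le _ ((hC c x (hψV c hx)).trans (le_abs_self _)) w
      calc _ ≤ ψ c x * (K ^ 2 * L * ‖w‖) + ε' * (|C c| * ‖w‖) := by gcongr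
        _ = _ := by ring
    · have h0 : ψ c =ᶠ[𝓝 x] fun _ ↦ (0 : ℝ) := notMem_tsupport_iff_eventuallyEq.1 hx
      have h1 : (fun z ↦ ψ c z * v c z) =ᶠ[𝓝 x] fun _ ↦ (0 : ℝ) := by
        filter_upwards [h0] with z hz
        rw [hz, zero_mul]
      rw [differential_apply_eq_zero h0, differential_apply_eq_zero h1, mul_zero, sub_zero,
        abs_zero]
      positivity
  have hsupp : tsupport (fun x ↦ ∑ c, ψ c x * v c x) ⊆ ⋃ c : t, V c := by
    refine closure_minimal (fun x hx ↦ ?_) (isClosed_iUnion_of_finite fun c ↦ (hVc c).isClosed)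
    obtain ⟨c, -, hc⟩ := Finset.exists_ne_zero_of_sum_ne_zero hx
    exact mem_iUnion.2 ⟨c, hψV c (subset_tsupport _ (left_ne_zero_of_mul hc))⟩
  refine ⟨fun x ↦ ∑ c, ψ c x * v c x, ⟨?_, ?_, ?_⟩, fun x ↦ ⟨⟨?_, ?_⟩, ?_, ?_⟩⟩
  · exact contMDiff_finsetSum fun c _ ↦ hsm c
  · exact (isCompact_iUnion fun c : t ↦ hVc c).of_isClosed_subset (isClosed_tsupport _) hsupp
  · exact hsupp.trans (iUnion_subset fun c ↦ (hVUB c).trans inter_subset_right)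
  · exact Finset.sum_nonneg fun c _ ↦ mul_nonneg (ψ.nonneg c x) (hv01 c x).1
  · exact (Finset.sum_le_sum fun c _ ↦
      mul_le_of_le_one_right (ψ.nonneg c x) (hv01 c x).2).trans (hψ1 x)
  · rw [hfψ x, ← Finset.sum_sub_distrib]
    refine (Finset.abs_sum_le_sum_abs _ _).trans ?_
    have : ∀ c ∈ Finset.univ, |ψ c x * v c x - ψ c x * f x| ≤ ψ c x * ε' := fun c _ ↦ by
      rw [← mul_sub, abs_mul, abs_of_nonneg (ψ.nonneg c x)]
      by_cases hx : ψ c x = 0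
      · simp [hx]
      · exact mul_le_mul_of_nonneg_left (hv c x (hψV c (subset_tsupport _ hx))).2.1 (ψ.nonneg c x)
    refine (Finset.sum_le_sum this).trans ?_
    rw [← Finset.sum_mul]
    nlinarith [hψ1 x]
  · refine ContinuousLinearMap.opNorm_le_bound _ (by positivity) fun w ↦ ?_
    rw [differential_sum_apply fun c _ ↦ (hsm c).mdifferentiable (by simp) x]
    -- Where `f x ≠ 0`, the point is interior to `S`, so `∑ ψ` is constantly `1` nearby.
    have hzero : f x * ∑ c, differential n (ψ c) x w = 0 := by
      by_cases hx : f x = 0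
      · simp [hx]
      · rw [← differential_sum_apply fun c _ ↦ (hψs c).mdifferentiable (by simp) x,
          differential_apply_eq_zero (a := 1), mul_zero]
        filter_upwards [isOpen_interior.mem_nhds (hfS x hx)] with z hz
        exact hψeq z (interior_subset hz)
    rw [← sub_zero (∑ c, _), ← hzero, Finset.mul_sum, ← Finset.sum_sub_distrib]
    refine (norm_sum_le _ _).trans ((Finset.sum_le_sum fun c _ ↦ hd x w c).trans ?_)
    rw [← Finset.sum_mul, Finset.sum_add_distrib, ← Finset.sum_mul, ← Finset.mul_sum]
    have h1 := mul_le_mul_of_nonneg_right (hψ1 x) (by positivity : 0 ≤ K ^ 2 * (L : ℝ))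
    refine mul_le_mul_of_nonneg_right ?_ (norm_nonneg w)
    nlinarith

end Cutoff

/-! ### Cutoffs on balls and volume of small balls. -/

section Balls

open Metric Set Manifold
open scoped NNReal Matrix

/-- Distances may be infinite, for instance between components; truncating before `toReal` keeps far
points from being sent to `0`. -/
lemma lipschitzWith_toReal_min_edist {X : Type*} [PseudoEMetricSpace X] (x₀ : X) {R : ENNReal}
    (hR : R ≠ ⊤) : LipschitzWith 1 fun x ↦ (min (edist x x₀) R).toReal := by
  have key : ∀ x y : X, edist x y ≠ ⊤ →
      (min (edist x x₀) R).toReal ≤ (min (edist y x₀) R).toReal + (edist x y).toReal := by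
    intro x y hxy
    have hy : min (edist y x₀) R ≠ ⊤ := ne_top_of_le_ne_top hR (min_le_right _ _)
    rw [← ENNReal.toReal_add hy hxy]
    refine ENNReal.toReal_mono (ENNReal.add_ne_top.2 ⟨hy, hxy⟩) ?_
    rw [min_add]
    refine le_min ((min_le_left _ _).trans ?_) ((min_le_right _ _).trans le_self_add)
    rw [add_comm]
    exact edist_triangle x y x₀
  intro x y
  by_cases hxy : edist x y = ⊤
  · simp [hxy]
  have h1 := key x y hxy
  have h2 := key y x (by rwa [edist_comm])
  rw [edist_comm y x] at h2
  rw [ENNReal.coe_one, one_mul, edist_dist, Real.dist_eq, ← ENNReal.ofReal_toReal hxy]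
  exact ENNReal.ofReal_le_ofReal (abs_le.2 ⟨by linarith, by linarith⟩)

/-- A lower bound for a symmetric bilinear form gives a lower bound for its determinant. -/
lemma pow_le_det_of_le_dotProduct_mulVec {n : ℕ} {G : Matrix (Fin n) (Fin n) ℝ}
    (hG : G.IsHermitian) {m : ℝ} (hm : 0 ≤ m) (h : ∀ w : Fin n → ℝ, m * (w ⬝ᵥ w) ≤ w ⬝ᵥ G *ᵥ w) :
    m ^ n ≤ G.det := by
  have hev : ∀ i, m ≤ hG.eigenvalues i := by
    intro i
    have h1 := h (hG.eigenvectorBasis i)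
    have h2 : (hG.eigenvectorBasis i).ofLp ⬝ᵥ (hG.eigenvectorBasis i).ofLp = 1 := by
      have := hG.eigenvectorBasis.orthonormal.1 i
      rw [EuclideanSpace.norm_eq, Real.sqrt_eq_one] at this
      rw [← this]
      simp [dotProduct, sq]
    rw [h2, mul_one] at h1
    rw [hG.eigenvalues_eq]
    simpa using h1
  rw [hG.det_eq_prod_eigenvalues]
  calc m ^ n = ∏ _i : Fin n, m := by simp
    _ ≤ ∏ i, hG.eigenvalues i := Finset.prod_le_prod (fun _ _ ↦ hm) fun i _ ↦ hev i

variable {n : ℕ} {M : Type*} [EMetricSpace M]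
  [ChartedSpace (EuclideanSpace ℝ (Fin n)) M]
  [RiemannianBundle (fun x : M ↦ TangentSpace (𝓡 n) x)]

lemma metricCoeff_isHermitian (c : M) (y : EuclideanSpace ℝ (Fin n)) :
    (metricCoeff c y).IsHermitian := by
  ext i j
  exact real_inner_comm (coordVec c y i) (coordVec c y j)

variable [IsManifold (𝓡 n) ∞ M]

lemma dotProduct_metricCoeff_mulVec (c : M) {y : EuclideanSpace ℝ (Fin n)}
    (hy : y ∈ (extChartAt (𝓡 n) c).target) (w : Fin n → ℝ) :
    w ⬝ᵥ metricCoeff c y *ᵥ w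
      = ‖ofCoord n c ((extChartAt (𝓡 n) c).symm y) (WithLp.toLp 2 w)‖ ^ 2 := by
  have hw : WithLp.toLp 2 w = ∑ i, w i • EuclideanSpace.single i (1 : ℝ) := by
    ext j; simp [Pi.single_apply]
  have h : ofCoord n c ((extChartAt (𝓡 n) c).symm y) (WithLp.toLp 2 w)
      = ∑ i, w i • coordVec c y i := by
    rw [hw, map_sum]
    refine Finset.sum_congr rfl fun i _ ↦ ?_
    rw [map_smul, coordVec, mfderiv_extChartAt_symm_eq c hy]
  rw [h, ← real_inner_self_eq_norm_sq, sum_inner]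
  simp only [inner_sum, real_inner_smul_left, real_inner_smul_right, dotProduct, Matrix.mulVec,
    metricCoeff, Matrix.of_apply, Finset.mul_sum]
  refine Finset.sum_congr rfl fun i _ ↦ Finset.sum_congr rfl fun j _ ↦ by ring

variable [IsContMDiffRiemannianBundle (𝓡 n) ∞ (EuclideanSpace ℝ (Fin n))
    (fun x : M ↦ TangentSpace (𝓡 n) x)] [IsRiemannianManifold (𝓡 n) M]

/-- The model is piecewise linear in the distance: `1` up to `ρ/2`, `0` from `9ρ/10` on, slope
`5/(2ρ)`. Stopping at `9ρ/10` leaves room for a compact support, even when `ρ = r`. Smoothing with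
`K = 7/5` gives `(49/25)(5/2) + 6/10 = 11/2`. -/
lemma exists_isTestFunction_ball [SecondCountableTopology M] (x₀ : M) {ρ : ℝ} (hρ : 0 < ρ)
    (hc : IsCompact (closedEBall x₀ (ENNReal.ofReal (9 / 10 * ρ)))) :
    ∃ φ : M → ℝ, IsTestFunction n (eball x₀ (ENNReal.ofReal ρ)) φ ∧
      (∀ x, φ x ∈ Icc (0 : ℝ) 1) ∧ (∀ x ∈ eball x₀ (ENNReal.ofReal (ρ / 2)), 1 / 2 ≤ φ x) ∧
      ∀ x, ‖differential n φ x‖ ≤ 11 / 2 / ρ := by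
  set L : ℝ≥0 := (5 / 2 / ρ).toNNReal with hLdef
  have hLρ : (L : ℝ) = 5 / 2 / ρ := Real.coe_toNNReal _ (by positivity)
  let d : M → ℝ := fun x ↦ (min (edist x x₀) (ENNReal.ofReal ρ)).toReal
  have hd : LipschitzWith 1 d := lipschitzWith_toReal_min_edist x₀ ENNReal.ofReal_ne_top
  let f : M → ℝ := fun x ↦ max 0 (min 1 (L * (9 / 10 * ρ - d x)))
  have hdlt : ∀ (x : M) (t : ℝ), t ≤ ρ → d x < t → edist x x₀ < ENNReal.ofReal t := by
    intro x t ht hx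
    have hmin : min (edist x x₀) (ENNReal.ofReal ρ) < ENNReal.ofReal t :=
      (ENNReal.lt_ofReal_iff_toReal_lt
        (ne_top_of_le_ne_top ENNReal.ofReal_ne_top (min_le_right _ _))).2 hx
    exact (min_lt_iff.1 hmin).resolve_right (ENNReal.ofReal_le_ofReal ht).not_gt
  have hf : LipschitzWith L f := by
    have h1 : LipschitzWith L fun x ↦ (L : ℝ) * (9 / 10 * ρ - d x) := by
      intro x y
      have h2 := hd x y
      rw [edist_dist, Real.dist_eq] at h2 ⊢
      rw [show (L : ℝ) * (9 / 10 * ρ - d x) - L * (9 / 10 * ρ - d y) = L * -(d x - d y) by ring,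
        abs_mul, abs_neg, NNReal.abs_eq, ENNReal.ofReal_mul L.coe_nonneg, ENNReal.ofReal_coe_nnreal]
      gcongr
      simpa using h2
    exact (h1.const_min 1).const_max 0
  have hfsupp : ∀ x, f x ≠ 0 → x ∈ interior (closedEBall x₀ (ENNReal.ofReal (9 / 10 * ρ))) := by
    intro x hx
    have h1 : d x < 9 / 10 * ρ := by
      by_contra! h
      apply hx
      have : (L : ℝ) * (9 / 10 * ρ - d x) ≤ 0 :=
        mul_nonpos_of_nonneg_of_nonpos L.coe_nonneg (by linarith)
      exact max_eq_left ((min_le_right _ _).trans this)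
    exact interior_maximal (eball_subset_closedEBall) isOpen_eball
      (hdlt x _ (by linarith) h1)
  obtain ⟨φ, hφ, hφx⟩ := exists_isTestFunction_approx (n := n) (K := 7 / 5)
    (ε := min (1 / 2) (6 / 10 / ρ)) (f := f) (isOpen_eball (x := x₀) (ε := ENNReal.ofReal ρ)) hc
    (fun x hx ↦ lt_of_le_of_lt hx ((ENNReal.ofReal_lt_ofReal_iff hρ).2 (by linarith)))
    (fun x ↦ ⟨le_max_left _ _, max_le zero_le_one (min_le_left _ _)⟩) hfsupp hf
    (by norm_num) (by positivity)
  · refine ⟨φ, hφ, fun x ↦ (hφx x).1, fun x hx ↦ ?_, fun x ↦ ?_⟩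
    · have h1 := (abs_le.1 ((hφx x).2.1.trans (min_le_left _ _))).1
      have h2 : d x ≤ ρ / 2 := by
        refine ENNReal.toReal_le_of_le_ofReal (by positivity) ((min_le_left _ _).trans ?_)
        exact le_of_lt hx
      have h3 : 1 ≤ (L : ℝ) * (9 / 10 * ρ - d x) := by
        rw [hLρ, div_mul_eq_mul_div, le_div_iff₀ hρ]; linarith
      have h4 : f x = 1 := by simp [f, h3]
      rw [h4] at h1
      linarith
    · refine (hφx x).2.2.trans ?_
      have := min_le_right (1 / 2 : ℝ) (6 / 10 / ρ)
      rw [hLρ]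
      calc _ ≤ (7 / 5 : ℝ) ^ 2 * (5 / 2 / ρ) + 6 / 10 / ρ := by linarith
        _ = 11 / 2 / ρ := by ring

variable [MeasurableSpace M] [BorelSpace M]

/-- Small balls have at least Euclidean volume growth. -/
lemma exists_le_riemannianVolume_eball (x₀ : M) :
    ∃ κ > 0, ∃ s₀ > 0, ∀ s : ℝ, 0 < s → s ≤ s₀ →
      ENNReal.ofReal (κ * s ^ n) ≤ riemannianVolume n M (eball x₀ (ENNReal.ofReal s)) := by
  obtain ⟨δ, hδ, C, hC, hball, hcomp⟩ := exists_ball_metric_comparison (n := n) x₀ one_lt_two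
  set e := extChartAt (𝓡 n) x₀ with he
  have hcomp' : ∀ y ∈ ball (e x₀) δ, e.symm y ∈ e.source ∧ e (e.symm y) ∈ ball (e x₀) δ := by
    intro y hy
    refine ⟨e.map_target (hball hy), ?_⟩
    rwa [e.right_inv (hball hy)]
  have hdist : ∀ y ∈ ball (e x₀) δ, edist (e.symm y) x₀
      ≤ ENNReal.ofReal (2 * ‖ofCoord n x₀ x₀‖ * ‖y - e x₀‖) := by
    intro y hy
    have h := edist_extChartAt_symm_le x₀ (convex_ball _ _) hball
      (fun y hy ↦ (hcomp _ (hcomp' y hy).1 (hcomp' y hy).2).1) (mem_ball_self hδ) hy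
    rw [extChartAt_to_inv, edist_comm] at h
    refine h.trans (ENNReal.ofReal_le_ofReal ?_)
    rw [mul_assoc]
    exact mul_le_mul_of_nonneg_left (ContinuousLinearMap.le_opNorm _ _) zero_le_two
  -- A vector with coordinates `w` has length at least `‖w‖ / C`, so every eigenvalue of the metric
  -- is at least `1 / C²`.
  have hdet : ∀ y ∈ ball (e x₀) δ, (1 / C ^ 2) ^ n ≤ (metricCoeff x₀ y).det := by
    intro y hy
    refine pow_le_det_of_le_dotProduct_mulVec (metricCoeff_isHermitian x₀ y) (by positivity)
      fun w ↦ ?_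
    rw [dotProduct_metricCoeff_mulVec x₀ (hball hy)]
    have h1 := (hcomp _ (hcomp' y hy).1 (hcomp' y hy).2).2.2
      (ofCoord n x₀ (e.symm y) (WithLp.toLp 2 w))
    rw [toCoord_ofCoord x₀ (hcomp' y hy).1] at h1
    have h2 : w ⬝ᵥ w = ‖WithLp.toLp 2 w‖ ^ 2 := by
      rw [EuclideanSpace.norm_sq_eq]
      simp [dotProduct, sq]
    rw [h2, one_div, inv_mul_le_iff₀ (by positivity), ← mul_pow]
    exact pow_le_pow_left₀ (norm_nonneg _) h1 2
  set N : ℝ := 2 * ‖ofCoord n x₀ x₀‖ + 1 with hN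
  have hNpos : 0 < N := by positivity
  set b : ℝ := Real.sqrt ((1 / C ^ 2) ^ n) with hb
  have hbpos : 0 < b := Real.sqrt_pos.2 (by positivity)
  set m₁ : ℝ := (volume (ball (0 : EuclideanSpace ℝ (Fin n)) 1)).toReal with hm₁
  have hm₁pos : 0 < m₁ := ENNReal.toReal_pos (measure_ball_pos _ _ one_pos).ne' measure_ball_lt_top.ne
  refine ⟨b * m₁ / N ^ n, by positivity, δ * N, by positivity, fun s hs hsδ ↦ ?_⟩
  have hsub : ball (e x₀) (s / N) ⊆ ball (e x₀) δ := ball_subset_ball (by rwa [div_le_iff₀ hNpos])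
  have hpre : ball (e x₀) (s / N) ⊆ e.symm ⁻¹' eball x₀ (ENNReal.ofReal s) := by
    intro y hy
    refine (hdist y (hsub hy)).trans_lt ((ENNReal.ofReal_lt_ofReal_iff hs).2 ?_)
    rw [mem_ball, dist_eq_norm, lt_div_iff₀ hNpos] at hy
    nlinarith [norm_nonneg (y - e x₀)]
  have htm : MeasurableSet e.target := (isOpen_extChartAt_target (I := 𝓡 n) x₀).measurableSet
  have hmeas : AEMeasurable e.symm ((volume.restrict e.target).withDensity
      fun y ↦ ENNReal.ofReal (Real.sqrt (metricCoeff x₀ y).det)) :=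
    ((continuousOn_extChartAt_symm x₀).aemeasurable htm).mono_ac
      (withDensity_absolutelyContinuous _ _)
  calc ENNReal.ofReal (b * m₁ / N ^ n * s ^ n)
      = ENNReal.ofReal b * volume (ball (e x₀) (s / N)) := by
        rw [Measure.addHaar_ball_of_pos _ _ (by positivity), finrank_euclideanSpace_fin,
          ← ENNReal.ofReal_toReal (measure_ball_lt_top (μ := volume)
            (x := (0 : EuclideanSpace ℝ (Fin n))) (r := 1)).ne, ← ENNReal.ofReal_mul (by positivity),
          ← ENNReal.ofReal_mul hbpos.le, ← hm₁, div_pow]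
        congr 1
        ring
    _ = ∫⁻ _ in ball (e x₀) (s / N), ENNReal.ofReal b ∂(volume.restrict e.target) := by
        rw [setLIntegral_const, Measure.restrict_apply measurableSet_ball,
          inter_eq_left.2 (hsub.trans hball)]
    _ ≤ ∫⁻ y in ball (e x₀) (s / N), ENNReal.ofReal (Real.sqrt (metricCoeff x₀ y).det)
          ∂(volume.restrict e.target) :=
        setLIntegral_mono' measurableSet_ball fun y hy ↦
          ENNReal.ofReal_le_ofReal (Real.sqrt_le_sqrt (hdet y (hsub hy)))
    _ = (volume.restrict e.target).withDensity
          (fun y ↦ ENNReal.ofReal (Real.sqrt (metricCoeff x₀ y).det)) (ball (e x₀) (s / N)) :=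
        (withDensity_apply _ measurableSet_ball).symm
    _ ≤ (volume.restrict e.target).withDensity
          (fun y ↦ ENNReal.ofReal (Real.sqrt (metricCoeff x₀ y).det))
          (e.symm ⁻¹' eball x₀ (ENNReal.ofReal s)) := measure_mono hpre
    _ = chartVolume n x₀ (eball x₀ (ENNReal.ofReal s)) :=
        (Measure.map_apply_of_aemeasurable hmeas isOpen_eball.measurableSet).symm
    _ ≤ riemannianVolume n M (eball x₀ (ENNReal.ofReal s)) :=
        Measure.le_iff'.1 (le_iSup (fun c : M ↦ chartVolume n c) x₀) _

end Balls

/-! ### The Sobolev inequality applied to a cutoff. -/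

section VolumeBound

open Metric Set Manifold

variable {n : ℕ} {M : Type*} [EMetricSpace M]
  [ChartedSpace (EuclideanSpace ℝ (Fin n)) M]

lemma IsTestFunction.mono {B B' : Set M} {φ : M → ℝ} (hφ : IsTestFunction n B φ) (h : B ⊆ B') :
    IsTestFunction n B' φ :=
  ⟨hφ.1, hφ.2.1, hφ.2.2.trans h⟩

variable [RiemannianBundle (fun x : M ↦ TangentSpace (𝓡 n) x)]

lemma norm_differential_eq_zero_of_notMem_tsupport {φ : M → ℝ} {x : M} (hx : x ∉ tsupport φ) :
    ‖differential n φ x‖ = 0 := by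
  refine le_antisymm (ContinuousLinearMap.opNorm_le_bound _ le_rfl fun w ↦ ?_)
    (norm_nonneg (differential n φ x))
  rw [differential_apply_eq_zero (notMem_tsupport_iff_eventuallyEq.1 hx) w]
  simp

variable [IsManifold (𝓡 n) ∞ M] [MeasurableSpace M] [BorelSpace M]

lemma IsTestFunction.isW012 {B : Set M} {φ : M → ℝ} (hφ : IsTestFunction n B φ) :
    IsW012 B φ (differential n φ) := by
  refine ⟨hφ.1.continuous.measurable.aemeasurable, fun X hX ↦ ?_, fun _ ↦ φ, fun _ ↦ hφ, ?_, ?_⟩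
  -- The pairing with `X` is the fibre component of the tangent map of `φ` along `X`, hence
  -- continuous.
  · have h1 : Continuous (tangentMap (𝓡 n) 𝓘(ℝ, ℝ) φ) := hφ.1.continuous_tangentMap (by simp)
    have h2 := ((tangentBundleModelSpaceHomeomorph 𝓘(ℝ, ℝ)).continuous.comp
      (h1.comp hX.continuous)).snd
    exact h2.measurable.aemeasurable
  · simp
  · have h : ∀ x, ‖differential n φ x - differential n φ x‖ₑ = 0 := fun x ↦ by
      rw [← ofReal_norm, ENNReal.ofReal_eq_zero]
      exact ContinuousLinearMap.opNorm_le_bound _ le_rfl fun w ↦ by simp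
    simp_rw [h]
    simp

/-- The Sobolev inequality applied to a cutoff function compares the volumes of concentric
balls. -/
lemma le_volume_of_perturbedSobolev [IsContMDiffRiemannianBundle (𝓡 n) ∞ (EuclideanSpace ℝ (Fin n))
    (fun x : M ↦ TangentSpace (𝓡 n) x)] [IsRiemannianManifold (𝓡 n) M]
    [SecondCountableTopology M] (hn : 3 ≤ n) {x₀ : M} {r : ℝ} (hr1 : r ≤ 1)
    (hcompact : ∀ ρ : ℝ, ρ < r → IsCompact (closedEBall x₀ (ENNReal.ofReal ρ)))
    (hR : ∀ x ∈ eball x₀ (ENNReal.ofReal r), |scalarCurvature n x| ≤ 1 / r ^ 2)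
    {A : ℝ} (hA : 1 ≤ A) (hSob : PerturbedSobolev n (eball x₀ (ENNReal.ofReal r)) A)
    (hfin : riemannianVolume n M (eball x₀ (ENNReal.ofReal r)) ≠ ⊤) {ρ : ℝ} (hρ : 0 < ρ)
    (hρr : ρ ≤ r) :
    ρ ^ 2 / (128 * A) * (riemannianVolume n M).real (eball x₀ (ENNReal.ofReal (ρ / 2)))
        ^ (((n : ℝ) - 2) / n)
      ≤ (riemannianVolume n M).real (eball x₀ (ENNReal.ofReal ρ)) := by
  set μ := riemannianVolume n M with hμ
  have hn' : (3 : ℝ) ≤ n := by exact_mod_cast hn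
  have hsub : eball x₀ (ENNReal.ofReal ρ) ⊆ eball x₀ (ENNReal.ofReal r) :=
    eball_subset_eball (ENNReal.ofReal_le_ofReal hρr)
  have hsub' : eball x₀ (ENNReal.ofReal (ρ / 2)) ⊆ eball x₀ (ENNReal.ofReal ρ) :=
    eball_subset_eball (ENNReal.ofReal_le_ofReal (by linarith))
  have hfinρ : μ (eball x₀ (ENNReal.ofReal ρ)) < ⊤ :=
    (measure_mono hsub).trans_lt hfin.lt_top
  have hfin2 : μ (eball x₀ (ENNReal.ofReal (ρ / 2))) < ⊤ := (measure_mono hsub').trans_lt hfinρ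
  obtain ⟨φ, hφ, hφ01, hφhalf, hφd⟩ :=
    exists_isTestFunction_ball (n := n) x₀ hρ (hcompact _ (by linarith))
  have hφ0 : ∀ x ∉ eball x₀ (ENNReal.ofReal ρ), x ∉ tsupport φ := fun x hx h ↦ hx (hφ.2.2 h)
  obtain ⟨hint, hsob⟩ := hSob φ (differential n φ) (hφ.mono hsub).isW012
  rw [← hμ] at hint hsob
  set θ : ℝ := ((n : ℝ) - 2) / n with hθ
  set p : ℝ := 2 * (n : ℝ) / ((n : ℝ) - 2) with hp
  have hp0 : 0 ≤ p := div_nonneg (by linarith) (by linarith)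
  have hθ0 : 0 ≤ θ := div_nonneg (by linarith) (by linarith)
  have hpθ : p * θ = 2 := by
    have : (n : ℝ) - 2 ≠ 0 := by linarith
    rw [hp, hθ]; field_simp
  -- The factor is `(1/2)^(pθ)` with `pθ = 2`.
  have hleft : (1 / 4 : ℝ) * μ.real (eball x₀ (ENNReal.ofReal (ρ / 2))) ^ θ
      ≤ (∫ x, |φ x| ^ p ∂μ) ^ θ := by
    have h1 : (1 / 2 : ℝ) ^ p * μ.real (eball x₀ (ENNReal.ofReal (ρ / 2))) ≤ ∫ x, |φ x| ^ p ∂μ := by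
      calc _ = ∫ _ in eball x₀ (ENNReal.ofReal (ρ / 2)), (1 / 2 : ℝ) ^ p ∂μ := by
            rw [setIntegral_const, smul_eq_mul, mul_comm]
        _ ≤ ∫ x in eball x₀ (ENNReal.ofReal (ρ / 2)), |φ x| ^ p ∂μ := by
            refine setIntegral_mono_on (integrableOn_const hfin2.ne) hint.integrableOn
              isOpen_eball.measurableSet fun x hx ↦ ?_
            exact Real.rpow_le_rpow (by norm_num) ((hφhalf x hx).trans (le_abs_self _)) hp0
        _ ≤ _ := setIntegral_le_integral hint
            (Filter.Eventually.of_forall fun x ↦ Real.rpow_nonneg (abs_nonneg _) _)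
    refine le_trans (le_of_eq ?_) (Real.rpow_le_rpow (by positivity) h1 hθ0)
    rw [Real.mul_rpow (by positivity) measureReal_nonneg, ← Real.rpow_mul (by norm_num), hpθ]
    norm_num
  have hρ2 : 0 < ρ ^ 2 := by positivity
  have hone : 1 ≤ 1 / ρ ^ 2 := by
    rw [le_div_iff₀ hρ2]
    nlinarith
  have hr2 : 1 / r ^ 2 ≤ 1 / ρ ^ 2 := one_div_le_one_div_of_le hρ2 (by gcongr)
  -- Here `61/2 = (11/2)² + 1/4`. With the `L²` term the total is `63/2`, and the factor `1/4` on
  -- the left turns it into `126 ≤ 128`.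
  have hen : ∫ x, (‖differential n φ x‖ ^ 2 + 1 / 4 * scalarCurvature n x * φ x ^ 2) ∂μ
      ≤ 61 / 2 * (1 / ρ ^ 2) * μ.real (eball x₀ (ENNReal.ofReal ρ)) := by
    rw [← setIntegral_eq_integral_of_forall_compl_eq_zero
      (s := eball x₀ (ENNReal.ofReal ρ)) fun x hx ↦ by
        rw [norm_differential_eq_zero_of_notMem_tsupport (hφ0 x hx),
          image_eq_zero_of_notMem_tsupport (hφ0 x hx)]
        simp]
    refine (Real.le_norm_self _).trans (norm_setIntegral_le_of_norm_le_const hfinρ fun x hx ↦ ?_)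
    have h1 : ‖differential n φ x‖ ^ 2 ≤ 121 / 4 * (1 / ρ ^ 2) := by
      rw [show 121 / 4 * (1 / ρ ^ 2) = (11 / 2 / ρ) ^ 2 by ring]
      exact pow_le_pow_left₀ (norm_nonneg (differential n φ x)) (hφd x) 2
    have h2 : |scalarCurvature n x| ≤ 1 / ρ ^ 2 := (hR x (hsub hx)).trans hr2
    have h3 : φ x ^ 2 ≤ 1 := pow_le_one₀ (hφ01 x).1 (hφ01 x).2
    refine (norm_add_le _ _).trans ?_
    rw [Real.norm_of_nonneg (sq_nonneg _), Real.norm_eq_abs, abs_mul, abs_mul, abs_sq,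
      abs_of_pos (by norm_num : (0 : ℝ) < 1 / 4)]
    have h4 : |scalarCurvature n x| * φ x ^ 2 ≤ 1 / ρ ^ 2 * 1 :=
      mul_le_mul h2 h3 (sq_nonneg _) (by positivity)
    linarith
  have hsq : ∫ x, φ x ^ 2 ∂μ ≤ 1 / ρ ^ 2 * μ.real (eball x₀ (ENNReal.ofReal ρ)) := by
    rw [← setIntegral_eq_integral_of_forall_compl_eq_zero
      (s := eball x₀ (ENNReal.ofReal ρ)) fun x hx ↦ by
        rw [image_eq_zero_of_notMem_tsupport (hφ0 x hx)]
        simp]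
    refine (Real.le_norm_self _).trans (norm_setIntegral_le_of_norm_le_const hfinρ fun x hx ↦ ?_)
    rw [Real.norm_of_nonneg (sq_nonneg _)]
    exact (pow_le_one₀ (hφ01 x).1 (hφ01 x).2).trans hone
  have hA0 : 0 < A := by linarith
  have htot := hleft.trans (hsob.trans (add_le_add (mul_le_mul_of_nonneg_left hen hA0.le)
    (mul_le_mul_of_nonneg_left hsq hA0.le)))
  set V := μ.real (eball x₀ (ENNReal.ofReal ρ))
  have hV : 0 ≤ V := measureReal_nonneg
  rw [div_mul_eq_mul_div, div_le_iff₀ (by positivity)]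
  have h5 := mul_le_mul_of_nonneg_left htot hρ2.le
  have h6 : ρ ^ 2 * (A * (61 / 2 * (1 / ρ ^ 2) * V) + A * (1 / ρ ^ 2 * V)) = 63 / 2 * (A * V) := by
    field_simp; ring
  rw [h6] at h5
  have h7 : 0 ≤ A * V := by positivity
  linarith

end VolumeBound

end RiemannianVolumeBound

/-! ### The volume bound along dyadic radii. -/

theorem lemmaA2 {n : ℕ} (hn : 3 ≤ n)
    {M : Type*} [EMetricSpace M] [SecondCountableTopology M]
    [ChartedSpace (EuclideanSpace ℝ (Fin n)) M] [IsManifold (𝓡 n) ∞ M]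
    [RiemannianBundle (fun x : M ↦ TangentSpace (𝓡 n) x)]
    [IsContMDiffRiemannianBundle (𝓡 n) ∞ (EuclideanSpace ℝ (Fin n))
      (fun x : M ↦ TangentSpace (𝓡 n) x)]
    [IsRiemannianManifold (𝓡 n) M]
    [MeasurableSpace M] [BorelSpace M]
    (x₀ : M) (r : ℝ) (hr : 0 < r) (hr1 : r ≤ 1)
    (hcompact : ∀ ρ : ℝ, ρ < r → IsCompact (Metric.closedEBall x₀ (ENNReal.ofReal ρ)))
    (hproper : ((Metric.eball x₀ (ENNReal.ofReal r))ᶜ).Nonempty)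
    (hR : ∀ x ∈ Metric.eball x₀ (ENNReal.ofReal r),
      |RiemannianVolumeBound.scalarCurvature n x| ≤ 1 / r ^ 2)
    (A : ℝ) (hA : 1 ≤ A)
    (hSob : RiemannianVolumeBound.PerturbedSobolev n (Metric.eball x₀ (ENNReal.ofReal r)) A) :
    ENNReal.ofReal
        ((2 : ℝ) ^ (-(((n : ℝ) + 5) * (n : ℝ) / 2)) * A ^ (-((n : ℝ) / 2)) * r ^ n)
      ≤ RiemannianVolumeBound.riemannianVolume n M (Metric.eball x₀ (ENNReal.ofReal r)) := by
  rcases eq_or_ne (RiemannianVolumeBound.riemannianVolume n M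
    (Metric.eball x₀ (ENNReal.ofReal r))) ⊤ with htop | hfin
  · rw [htop]; exact le_top
  have hA0 : 0 < A := by linarith
  have hhalf : ∀ k : ℕ, 0 < r * (1 / 2 : ℝ) ^ k := fun k ↦ by positivity
  have hle : ∀ k : ℕ, r * (1 / 2 : ℝ) ^ k ≤ r := fun k ↦
    mul_le_of_le_one_right hr.le (pow_le_one₀ (by norm_num) (by norm_num))
  obtain ⟨κ, hκ, s₀, hs₀, hlow⟩ := RiemannianVolumeBound.exists_le_riemannianVolume_eball (n := n) x₀
  obtain ⟨N, hN⟩ := exists_pow_lt_of_lt_one (div_pos hs₀ hr) (by norm_num : (1 / 2 : ℝ) < 1)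
  have hbound := RiemannianVolumeBound.le_of_iterated_bound (n := n)
    (c := r ^ 2 / (128 * A)) (κ := κ * r ^ n) (N := N)
    (a := fun k ↦ (RiemannianVolumeBound.riemannianVolume n M).real
      (Metric.eball x₀ (ENNReal.ofReal (r * (1 / 2 : ℝ) ^ k))))
    (by omega) (by positivity) (by positivity) (fun k ↦ measureReal_nonneg) (fun k hk ↦ ?_)
    (fun k ↦ ?_)
  · rw [pow_zero, mul_one] at hbound
    rw [← ENNReal.ofReal_toReal hfin]
    refine ENNReal.ofReal_le_ofReal (le_trans (le_of_eq ?_) hbound)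
    -- The exponents of `2` combine as `7n/2 + n(n-2)/2 = (n+5)n/2`.
    have h128 : (128 : ℝ) = 2 ^ (7 : ℝ) := by norm_num
    have hr2 : (r ^ 2) ^ ((n : ℝ) / 2) = r ^ n := by
      rw [← Real.rpow_natCast r 2, ← Real.rpow_mul hr.le, ← Real.rpow_natCast r n]
      congr 1
      push_cast; ring
    rw [Real.div_rpow (by positivity) (by positivity), Real.mul_rpow (by norm_num) hA0.le, hr2,
      h128, ← Real.rpow_mul (by norm_num), div_eq_mul_inv (r ^ n), mul_inv,
      ← Real.rpow_neg (by norm_num),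
      ← Real.rpow_neg hA0.le]
    have h2 : (2 : ℝ) ^ (-(((n : ℝ) + 5) * (n : ℝ) / 2))
        = 2 ^ (-(7 * ((n : ℝ) / 2))) * 2 ^ (-((n : ℝ) * ((n : ℝ) - 2) / 2)) := by
      rw [← Real.rpow_add (by norm_num)]
      congr 1
      ring
    rw [h2]
    ring
  · have hk' : r * (1 / 2 : ℝ) ^ k ≤ s₀ := by
      have : (1 / 2 : ℝ) ^ k ≤ s₀ / r :=
        (pow_le_pow_of_le_one (by norm_num) (by norm_num) hk).trans hN.le
      rw [le_div_iff₀ hr] at this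
      linarith
    have h := hlow _ (hhalf k) hk'
    have hfink : RiemannianVolumeBound.riemannianVolume n M
        (Metric.eball x₀ (ENNReal.ofReal (r * (1 / 2 : ℝ) ^ k))) ≠ ⊤ :=
      ne_top_of_le_ne_top hfin
        (measure_mono (Metric.eball_subset_eball (ENNReal.ofReal_le_ofReal (hle k))))
    rw [mul_assoc, ← mul_pow]
    exact (ENNReal.ofReal_le_iff_le_toReal hfink).1 h
  · have h := RiemannianVolumeBound.le_volume_of_perturbedSobolev hn hr1 hcompact hR hA hSob
      hfin (hhalf k) (hle k)
    refine le_trans (le_of_eq ?_) h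
    rw [show r * (1 / 2 : ℝ) ^ k / 2 = r * (1 / 2 : ℝ) ^ (k + 1) by ring]
    ring
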